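/- **Alessandrini's identity, complex case.** Let $n\ge 2$, let $\Omega\subset\mathbb R^n$ be a bounded open set, let $\lambda\ge 1$, and call $\gamma$ *admissible* if $\gamma:\Omega\to\mathbb C$ is measurable with $\Re\gamma\ge\lambda^{-1}$ and $|\gamma|\le\lambda$ a.e. in $\Omega$. Let $H^1(\Omega)$ be the complex Sobolev space, $H^1_0(\Omega)$ the closure of $C_c^\infty(\Omega)$ in it, and let $H^{1/2}(\partial\Omega)=H^1(\Omega)/H^1_0(\Omega)$ be the space of boundary values of $H^1(\Omega)$ functions, with the quotient norm (for a bounded Lipschitz domain this is the usual trace space); write $u|_{\partial\Omega}$ for the class of $u$. Let $H^{-1/2}(\partial\Omega)$ be the space of bounded antilinear functionals on $H^{1/2}(\partial\Omega)$. Write $\xi\cdot\eta=\sum_i\xi_i\eta_i$ for $\xi,\eta\in\mathbb C^n$ (no conjugation). The equation $\operatorname{div}(\gamma\nabla u)=0$ in $\Omega$ is meant weakly: $u\in H^1(\Omega)$ and $\int_\Omega\gamma\nabla u\cdot\nabla\varphi=0$ for all $\varphi\in C_c^\infty(\Omega;\mathbb C)$. 1. Let $\gamma$ be admissible. For every $f\in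 H^{1/2}(\partial\Omega)$ there is exactly one $u\in H^1(\Omega)$ with $\operatorname{div}(\gamma\nabla u)=0$ in $\Omega$ and $u|_{\partial\Omega}=f$. The Dirichlet-to-Neumann map $\Lambda_\gamma$, $f\mapsto\gamma\,\partial u/\partial\nu$, is well defined as a bounded linear operator $H^{1/2}(\partial\Omega)\to H^{-1/2}(\partial\Omega)$ by $$\langle\Lambda_\gamma f,\psi\rangle=\int_\Omega\gamma\nabla u\cdot\nabla\overline v ,$$ where $u$ is the solution with boundary value $f$ and $v\in H^1(\Omega)$ is any function with $v|_{\partial\Omega}=\psi$. It is symmetric for the non-Hermitian pairing: for all $u,v\in H^1(\Omega)$, $$\langle\Lambda_\gamma(u|_{\partial\Omega}),\overline v|_{\partial\Omega}\rangle=\langle\Lambda_\gamma(v|_{\partial\Omega}),\overline u|_{\partial\Omega}\rangle .$$ 2. Let $\gamma^{(1)},\gamma^{(2)}$ be admissible, $\Lambda_k=\Lambda_{\gamma^{(k)}}$, and let $u_k\in H^1(\Omega)$ satisfy $\operatorname{div}(\gamma^{(k)}\nabla u_k)=0$ in $\Omega$, $k=1,2$. Then $$\int_\Omega(\gamma^{(1)}-\gamma^{(2)})\nabla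 u_1\cdot\nabla u_2=\langle(\Lambda_1-\Lambda_2)(u_2|_{\partial\Omega}),\overline u_1|_{\partial\Omega}\rangle .$$ -/

import Mathlib

open MeasureTheory Filter Topology
open scoped ContDiff ComplexConjugate

noncomputable section

namespace EIT

variable {n : ℕ}

/-- `∂φ/∂x_i` for a smooth function `φ : ℝⁿ → ℂ`. -/
def partialDeriv (i : Fin n) (φ : EuclideanSpace ℝ (Fin n) → ℂ) (x : EuclideanSpace ℝ (Fin n)) :
    ℂ :=
  fderiv ℝ φ x (EuclideanSpace.single i 1)

/-- `φ ∈ C_c^∞(Ω; ℂ)`. -/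
structure IsTestFunction (Ω : Set (EuclideanSpace ℝ (Fin n)))
    (φ : EuclideanSpace ℝ (Fin n) → ℂ) : Prop where
  contDiff : ContDiff ℝ ∞ φ
  hasCompactSupport : HasCompactSupport φ
  tsupport_subset : tsupport φ ⊆ Ω

/-- Complex `L²(Ω)`, with Lebesgue measure. -/
abbrev L2 (Ω : Set (EuclideanSpace ℝ (Fin n))) : Type :=
  Lp ℂ 2 ((volume : Measure (EuclideanSpace ℝ (Fin n))).restrict Ω)

/-- `g` is the weak derivative `∂u/∂x_i` in `Ω`. -/
def IsWeakPartial (Ω : Set (EuclideanSpace ℝ (Fin n))) (i : Fin n) (u g : L2 Ω) : Prop :=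
  ∀ φ : EuclideanSpace ℝ (Fin n) → ℂ, IsTestFunction Ω φ →
    ∫ x in Ω, u x * partialDeriv i φ x = -∫ x in Ω, g x * φ x

theorem IsTestFunction.memLp {Ω : Set (EuclideanSpace ℝ (Fin n))}
    {φ : EuclideanSpace ℝ (Fin n) → ℂ} (hφ : IsTestFunction Ω φ) :
    MemLp φ 2 (volume.restrict Ω) :=
  (hφ.contDiff.continuous.memLp_of_hasCompactSupport hφ.hasCompactSupport).restrict Ω

theorem IsTestFunction.memLp_partialDeriv {Ω : Set (EuclideanSpace ℝ (Fin n))}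
    {φ : EuclideanSpace ℝ (Fin n) → ℂ} (hφ : IsTestFunction Ω φ) (i : Fin n) :
    MemLp (partialDeriv i φ) 2 (volume.restrict Ω) := by
  have hc : Continuous (partialDeriv i φ) :=
    (hφ.contDiff.continuous_fderiv (by simp)).clm_apply continuous_const
  exact (hc.memLp_of_hasCompactSupport
    (hφ.hasCompactSupport.fderiv_apply ℝ (EuclideanSpace.single i 1))).restrict Ω

theorem integrable_L2_mul {Ω : Set (EuclideanSpace ℝ (Fin n))} (u : L2 Ω)
    {f : EuclideanSpace ℝ (Fin n) → ℂ} (hf : MemLp f 2 (volume.restrict Ω)) :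
    Integrable (fun x => u x * f x) (volume.restrict Ω) :=
  (Lp.memLp u).integrable_mul hf

theorem IsWeakPartial.add {Ω : Set (EuclideanSpace ℝ (Fin n))} {i : Fin n} {u v g h : L2 Ω}
    (hu : IsWeakPartial Ω i u g) (hv : IsWeakPartial Ω i v h) :
    IsWeakPartial Ω i (u + v) (g + h) := by
  intro φ hφ
  have e1 : ∫ x in Ω, (u + v : L2 Ω) x * partialDeriv i φ x
      = ∫ x in Ω, (u x * partialDeriv i φ x + v x * partialDeriv i φ x) := by
    refine integral_congr_ae ?_
    filter_upwards [Lp.coeFn_add u v] with x hx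
    rw [hx, Pi.add_apply, add_mul]
  have e2 : ∫ x in Ω, (g + h : L2 Ω) x * φ x = ∫ x in Ω, (g x * φ x + h x * φ x) := by
    refine integral_congr_ae ?_
    filter_upwards [Lp.coeFn_add g h] with x hx
    rw [hx, Pi.add_apply, add_mul]
  rw [e1, e2, integral_add (integrable_L2_mul u (hφ.memLp_partialDeriv i))
    (integrable_L2_mul v (hφ.memLp_partialDeriv i)),
    integral_add (integrable_L2_mul g hφ.memLp) (integrable_L2_mul h hφ.memLp),
    hu φ hφ, hv φ hφ, neg_add]

theorem IsWeakPartial.smul {Ω : Set (EuclideanSpace ℝ (Fin n))} {i : Fin n} {u g : L2 Ω}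
    (c : ℂ) (hu : IsWeakPartial Ω i u g) : IsWeakPartial Ω i (c • u) (c • g) := by
  intro φ hφ
  have e1 : ∫ x in Ω, (c • u : L2 Ω) x * partialDeriv i φ x
      = ∫ x in Ω, c * (u x * partialDeriv i φ x) := by
    refine integral_congr_ae ?_
    filter_upwards [Lp.coeFn_smul c u] with x hx
    rw [hx, Pi.smul_apply, smul_eq_mul, mul_assoc]
  have e2 : ∫ x in Ω, (c • g : L2 Ω) x * φ x = ∫ x in Ω, c * (g x * φ x) := by
    refine integral_congr_ae ?_
    filter_upwards [Lp.coeFn_smul c g] with x hx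
    rw [hx, Pi.smul_apply, smul_eq_mul, mul_assoc]
  rw [e1, e2, integral_const_mul, integral_const_mul, hu φ hφ, mul_neg]

theorem IsWeakPartial.zero (Ω : Set (EuclideanSpace ℝ (Fin n))) (i : Fin n) :
    IsWeakPartial Ω i 0 0 := by
  intro φ _
  have e (f : EuclideanSpace ℝ (Fin n) → ℂ) : ∫ x in Ω, (0 : L2 Ω) x * f x = 0 := by
    rw [← integral_zero (EuclideanSpace ℝ (Fin n)) ℂ (μ := volume.restrict Ω)]
    refine integral_congr_ae ?_
    filter_upwards [Lp.coeFn_zero ℂ 2 (volume.restrict Ω)] with x hx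
    rw [hx, Pi.zero_apply, zero_mul]
  rw [e, e, neg_zero]

/-- A test function may be replaced by its complex conjugate. -/
theorem IsTestFunction.conj {Ω : Set (EuclideanSpace ℝ (Fin n))}
    {φ : EuclideanSpace ℝ (Fin n) → ℂ} (hφ : IsTestFunction Ω φ) :
    IsTestFunction Ω (fun x => conj (φ x)) where
  contDiff := Complex.conjCLE.contDiff.comp hφ.contDiff
  hasCompactSupport := hφ.hasCompactSupport.comp_left (g := fun z : ℂ => conj z) (map_zero _)
  tsupport_subset := (tsupport_comp_subset (g := fun z : ℂ => conj z) (map_zero _) φ).trans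
    hφ.tsupport_subset

theorem IsTestFunction.partialDeriv_conj {Ω : Set (EuclideanSpace ℝ (Fin n))}
    {φ : EuclideanSpace ℝ (Fin n) → ℂ} (hφ : IsTestFunction Ω φ) (i : Fin n)
    (x : EuclideanSpace ℝ (Fin n)) :
    partialDeriv i (fun y => conj (φ y)) x = conj (partialDeriv i φ x) := by
  have hd : DifferentiableAt ℝ φ x := hφ.contDiff.differentiable (by simp) x
  have h := (Complex.conjCLE.toContinuousLinearMap.hasFDerivAt.comp x hd.hasFDerivAt).fderiv
  unfold partialDeriv
  change fderiv ℝ (⇑Complex.conjCLE.toContinuousLinearMap ∘ φ) x _ = _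
  rw [h]
  rfl

theorem IsWeakPartial.star {Ω : Set (EuclideanSpace ℝ (Fin n))} {i : Fin n} {u g : L2 Ω}
    (hu : IsWeakPartial Ω i u g) : IsWeakPartial Ω i (star u) (star g) := by
  intro φ hφ
  have e1 : ∫ x in Ω, (Star.star u : L2 Ω) x * partialDeriv i φ x
      = ∫ x in Ω, conj (u x * partialDeriv i (fun y => conj (φ y)) x) := by
    refine integral_congr_ae ?_
    filter_upwards [Lp.coeFn_star u] with x hx
    rw [hx, hφ.partialDeriv_conj, map_mul, Complex.conj_conj]
    rfl
  have e2 : ∫ x in Ω, (Star.star g : L2 Ω) x * φ x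
      = ∫ x in Ω, conj (g x * conj (φ x)) := by
    refine integral_congr_ae ?_
    filter_upwards [Lp.coeFn_star g] with x hx
    rw [hx, map_mul, Complex.conj_conj]
    rfl
  rw [e1, e2, integral_conj, integral_conj, hu _ hφ.conj, map_neg]

/-- The complex Sobolev space `H¹(Ω) = W^{1,2}(Ω)`: pairs `(u, g)` with `u ∈ L²(Ω)` and
`g = (g_1, …, g_n) ∈ L²(Ω)ⁿ` its weak gradient, with the norm
`‖u‖² = ‖u‖²_{L²} + ∑ i, ‖∂u/∂x_i‖²_{L²}`. -/
def H1 (Ω : Set (EuclideanSpace ℝ (Fin n))) :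
    Submodule ℂ (WithLp 2 (L2 Ω × PiLp 2 (fun _ : Fin n => L2 Ω))) where
  carrier := {p | ∀ i, IsWeakPartial Ω i p.fst (p.snd i)}
  add_mem' hp hq i := (hp i).add (hq i)
  zero_mem' i := IsWeakPartial.zero Ω i
  smul_mem' c _ hp i := (hp i).smul c

variable {Ω : Set (EuclideanSpace ℝ (Fin n))}

/-- The underlying `L²` function of `u ∈ H¹(Ω)`. -/
def fn (u : H1 Ω) : L2 Ω := u.1.fst

/-- The weak derivative `∂u/∂x_i` of `u ∈ H¹(Ω)`. -/
def grad (u : H1 Ω) (i : Fin n) : L2 Ω := u.1.snd i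

/-- The complex conjugate `ū ∈ H¹(Ω)` of `u ∈ H¹(Ω)`. -/
def conjH1 (u : H1 Ω) : H1 Ω :=
  ⟨WithLp.toLp 2 (star (fn u), WithLp.toLp 2 fun i => star (grad u i)), fun i => (u.2 i).star⟩

variable (Ω) in
/-- `H¹₀(Ω)`: the closure of `C_c^∞(Ω)` in `H¹(Ω)`. -/
def H10 : Submodule ℂ (H1 Ω) :=
  (Submodule.span ℂ {u : H1 Ω | ∃ φ : EuclideanSpace ℝ (Fin n) → ℂ,
    IsTestFunction Ω φ ∧ fn u =ᵐ[volume.restrict Ω] φ}).topologicalClosure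

variable (Ω) in
/-- `H^{1/2}(∂Ω)`, the space of boundary values of `H¹(Ω)` functions, with the quotient norm
`‖f‖ = inf {‖u‖_{H¹(Ω)} : u = f on ∂Ω}`. Two `H¹(Ω)` functions have the same boundary value iff
their difference is in `H¹₀(Ω)`. (For a bounded Lipschitz domain the trace operator
`H¹(Ω) → L²(∂Ω)` has kernel `H¹₀(Ω)` and range `H^{1/2}(∂Ω)`.) -/
abbrev HHalf : Type := H1 Ω ⧸ H10 Ω

variable (Ω) in
/-- `H^{-1/2}(∂Ω)`: the bounded antilinear functionals on `H^{1/2}(∂Ω)`. -/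
abbrev HNegHalf : Type := HHalf Ω →L⋆[ℂ] ℂ

/-- The boundary value `u|_{∂Ω} ∈ H^{1/2}(∂Ω)` of `u ∈ H¹(Ω)`. -/
def trace (u : H1 Ω) : HHalf Ω := (H10 Ω).mkQ u

/-- `∫_Ω γ ∇u · ∇v`, with the bilinear product `ξ · η = ∑ i, ξ_i η_i` on `ℂⁿ`
(no conjugation). -/
def gradForm (γ : EuclideanSpace ℝ (Fin n) → ℂ) (u v : H1 Ω) : ℂ :=
  ∫ x in Ω, γ x * ∑ i, grad u i x * grad v i x

/-- `u ∈ H¹(Ω)` solves `div (γ ∇u) = 0` in `Ω` in the weak sense. -/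
def IsWeakSolution (γ : EuclideanSpace ℝ (Fin n) → ℂ) (u : H1 Ω) : Prop :=
  ∀ φ : EuclideanSpace ℝ (Fin n) → ℂ, IsTestFunction Ω φ →
    ∫ x in Ω, γ x * ∑ i, grad u i x * partialDeriv i φ x = 0

variable (Ω) in
/-- Complex strongly elliptic coefficients: `γ ∈ L^∞(Ω; ℂ)` with `Re γ ≥ λ⁻¹` and `|γ| ≤ λ` almost
everywhere in `Ω`. -/
structure IsAdmittivity (lam : ℝ) (γ : EuclideanSpace ℝ (Fin n) → ℂ) : Prop where
  aestronglyMeasurable : AEStronglyMeasurable γ (volume.restrict Ω)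
  re_ge : ∀ᵐ x ∂(volume.restrict Ω), lam⁻¹ ≤ (γ x).re
  norm_le : ∀ᵐ x ∂(volume.restrict Ω), ‖γ x‖ ≤ lam

/-- The bounded linear operator `Λ : H^{1/2}(∂Ω) → H^{-1/2}(∂Ω)` is the Dirichlet-to-Neumann map
`f ↦ γ ∂u/∂ν` of `γ`: `⟨Λ f, ψ⟩ = ∫_Ω γ ∇u · ∇v̄` whenever `u ∈ H¹(Ω)` solves
`div (γ ∇u) = 0` in `Ω` with `u = f` on `∂Ω`, and `v ∈ H¹(Ω)` is any function with
`v = ψ` on `∂Ω`. -/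
def IsDirichletToNeumann (γ : EuclideanSpace ℝ (Fin n) → ℂ) (Λ : HHalf Ω →L[ℂ] HNegHalf Ω) :
    Prop :=
  ∀ (f ψ : HHalf Ω) (u v : H1 Ω), IsWeakSolution γ u → trace u = f → trace v = ψ →
    Λ f ψ = gradForm γ u (conjH1 v)

open Classical in
variable (Ω) in
/-- The Dirichlet-to-Neumann map `Λ_γ` (the value `0` is used only if there is no operator with
the defining property). -/
def dirichletToNeumann (γ : EuclideanSpace ℝ (Fin n) → ℂ) : HHalf Ω →L[ℂ] HNegHalf Ω :=
  if h : ∃ Λ : HHalf Ω →L[ℂ] HNegHalf Ω, IsDirichletToNeumann γ Λ then h.choose else 0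

end EIT

end

/-!
The Dirichlet problem is solved by the Lax–Milgram theorem. The space `H¹(Ω)` is closed in
`L²(Ω) × L²(Ω)ⁿ` (`EIT.isClosed_H1`), hence a Hilbert space, and `a(u, v) = ∫_Ω γ ∇u · ∇v̄` is a
bounded sesquilinear form on it (`EIT.sesqFormL`). Since `Re γ ≥ λ⁻¹`, its real part dominates
`λ⁻¹ ∑ i, ‖∂u/∂x_i‖²`, which on `H¹₀(Ω)` controls the full norm by the Poincaré inequality
(`EIT.norm_fn_le_of_mem_H10`); so `a` is coercive on `H¹₀(Ω)` (`EIT.exists_coercive_H10`). The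
Poincaré inequality itself comes from testing the definition of `∂φ/∂x_i` with `x_i φ̄`, which gives
`‖φ‖² = -2 Re ∫ x_i ∂φ/∂x_i φ̄`, where `x_i` is bounded on `Ω`.

By density, weak solutions are exactly the functions that annihilate `H¹₀(Ω)` under the form
(`EIT.isWeakSolution_iff`). Lax–Milgram therefore gives a bounded projection of `H¹(Ω)` onto the
weak solutions with kernel `H¹₀(Ω)`, which descends to a bounded solution operator `P` on
`H^{1/2}(∂Ω)` (`EIT.exists_solutionOperator`), and `Λ f ψ = a(P f, P ψ)` is the
Dirichlet-to-Neumann map.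

If `u` and `v` are weak solutions for `γ`, then `Λ_γ` sends `(u, v̄)` to `∫_Ω γ ∇u · ∇v`, which is
symmetric in `u` and `v`; as `H¹₀(Ω)` is stable under conjugation, the same symmetry holds for the
boundary values of arbitrary `H¹(Ω)` functions. Alessandrini's identity follows by applying it to
`Λ_{γ₁}`.
-/

noncomputable section

namespace EIT

variable {n : ℕ} {Ω : Set (EuclideanSpace ℝ (Fin n))}

/-! ### The Sobolev space as a Hilbert space -/

variable (Ω) in
/-- The inclusion `H¹(Ω) → L²(Ω)` as a continuous linear map. -/
def fnL : H1 Ω →L[ℂ] L2 Ω :=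
  (WithLp.fstL 2 ℂ (L2 Ω) (PiLp 2 fun _ : Fin n => L2 Ω)).comp (H1 Ω).subtypeL

variable (Ω) in
/-- The weak derivative `∂/∂x_i : H¹(Ω) → L²(Ω)` as a continuous linear map. -/
def gradL (i : Fin n) : H1 Ω →L[ℂ] L2 Ω :=
  ((PiLp.proj 2 (fun _ : Fin n => L2 Ω) i).comp
    (WithLp.sndL 2 ℂ (L2 Ω) (PiLp 2 fun _ : Fin n => L2 Ω))).comp (H1 Ω).subtypeL

@[simp]
theorem gradL_apply (i : Fin n) (u : H1 Ω) : gradL Ω i u = grad u i := rfl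

theorem norm_sq_H1 (u : H1 Ω) : ‖u‖ ^ 2 = ‖fn u‖ ^ 2 + ∑ i, ‖grad u i‖ ^ 2 := by
  change ‖(u : WithLp 2 (L2 Ω × PiLp 2 (fun _ : Fin n => L2 Ω)))‖ ^ 2 = _
  rw [WithLp.prod_norm_sq_eq_of_L2, PiLp.norm_sq_eq_of_L2]
  rfl

theorem continuous_integral_L2_mul {f : EuclideanSpace ℝ (Fin n) → ℂ}
    (hf : MemLp f 2 (volume.restrict Ω)) :
    Continuous fun u : L2 Ω => ∫ x in Ω, u x * f x := by
  have h : (fun u : L2 Ω => ∫ x in Ω, u x * f x)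
      = fun u => (ContinuousLinearMap.mul ℂ ℂ).lpPairing (volume.restrict Ω) 2 2 u hf.toLp := by
    funext u
    rw [ContinuousLinearMap.lpPairing_eq_integral]
    refine integral_congr_ae ?_
    filter_upwards [hf.coeFn_toLp] with x hx
    simp [hx]
  rw [h]
  fun_prop

theorem isClosed_H1 (Ω : Set (EuclideanSpace ℝ (Fin n))) :
    IsClosed (H1 Ω : Set (WithLp 2 (L2 Ω × PiLp 2 (fun _ : Fin n => L2 Ω)))) := by
  have h : (H1 Ω : Set (WithLp 2 (L2 Ω × PiLp 2 (fun _ : Fin n => L2 Ω))))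
      = ⋂ (i : Fin n) (φ : EuclideanSpace ℝ (Fin n) → ℂ) (_ : IsTestFunction Ω φ),
        {p | ∫ x in Ω, p.fst x * partialDeriv i φ x = -∫ x in Ω, p.snd i x * φ x} := by
    ext p
    simp only [Set.mem_iInter]
    rfl
  rw [h]
  refine isClosed_iInter fun i => isClosed_iInter fun φ => isClosed_iInter fun hφ =>
    isClosed_eq ?_ ?_
  · exact (continuous_integral_L2_mul (hφ.memLp_partialDeriv i)).comp
      (WithLp.fstL 2 ℂ (L2 Ω) (PiLp 2 fun _ : Fin n => L2 Ω)).continuous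
  · exact ((continuous_integral_L2_mul hφ.memLp).comp
      ((PiLp.proj 2 (fun _ : Fin n => L2 Ω) i).comp
        (WithLp.sndL 2 ℂ (L2 Ω) (PiLp 2 fun _ : Fin n => L2 Ω))).continuous).neg

instance : CompleteSpace (H1 Ω) := (isClosed_H1 Ω).completeSpace_coe

theorem isClosed_H10 (Ω : Set (EuclideanSpace ℝ (Fin n))) : IsClosed (H10 Ω : Set (H1 Ω)) :=
  Submodule.isClosed_topologicalClosure _

instance : CompleteSpace (H10 Ω) := (isClosed_H10 Ω).completeSpace_coe

/-! ### Complex conjugation on the Sobolev space -/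

@[simp]
theorem conjH1_conjH1 (u : H1 Ω) : conjH1 (conjH1 u) = u := by
  apply Subtype.ext
  apply WithLp.ofLp_injective
  refine Prod.ext (star_star _) ?_
  apply WithLp.ofLp_injective
  funext i
  exact star_star _

theorem fn_conjH1 (u : H1 Ω) : fn (conjH1 u) = star (fn u) := rfl

theorem grad_conjH1 (u : H1 Ω) (i : Fin n) : grad (conjH1 u) i = star (grad u i) := rfl

theorem star_smul_L2 (c : ℂ) (f : L2 Ω) : star (c • f) = conj c • star f := by
  apply Lp.ext
  filter_upwards [Lp.coeFn_star (c • f), Lp.coeFn_smul c f, Lp.coeFn_star f,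
    Lp.coeFn_smul (conj c) (star f)] with x h1 h2 h3 h4
  rw [h1, h4, Pi.star_apply, h2, Pi.smul_apply, Pi.smul_apply, h3, Pi.star_apply, star_smul]
  rfl

theorem star_add_L2 (f g : L2 Ω) : star (f + g) = star f + star g := by
  apply Lp.ext
  filter_upwards [Lp.coeFn_star (f + g), Lp.coeFn_add f g, Lp.coeFn_star f, Lp.coeFn_star g,
    Lp.coeFn_add (star f) (star g)] with x h1 h2 h3 h4 h5
  rw [h1, h5, Pi.star_apply, h2, Pi.add_apply, Pi.add_apply, h3, h4, Pi.star_apply, Pi.star_apply,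
    star_add]

theorem norm_star_L2 (f : L2 Ω) : ‖star f‖ = ‖f‖ := by
  rw [Lp.norm_def, Lp.norm_def]
  congr 1
  refine eLpNorm_congr_norm_ae ?_
  filter_upwards [Lp.coeFn_star f] with x hx
  rw [hx, Pi.star_apply, norm_star]

theorem norm_conjH1 (u : H1 Ω) : ‖conjH1 u‖ = ‖u‖ := by
  rw [← sq_eq_sq₀ (norm_nonneg _) (norm_nonneg _), norm_sq_H1, norm_sq_H1]
  simp only [fn_conjH1, grad_conjH1, norm_star_L2]

variable (Ω) in
/-- Complex conjugation `u ↦ ū` on `H¹(Ω)` as a continuous antilinear map. -/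
def conjL : H1 Ω →L⋆[ℂ] H1 Ω :=
  LinearMap.mkContinuous
    { toFun := conjH1
      map_add' u v := by
        apply Subtype.ext
        apply WithLp.ofLp_injective
        refine Prod.ext (star_add_L2 (fn u) (fn v)) ?_
        apply WithLp.ofLp_injective
        funext i
        exact star_add_L2 (grad u i) (grad v i)
      map_smul' c u := by
        apply Subtype.ext
        apply WithLp.ofLp_injective
        refine Prod.ext (star_smul_L2 c (fn u)) ?_
        apply WithLp.ofLp_injective
        funext i
        exact star_smul_L2 c (grad u i) } 1 fun u => by
    rw [one_mul]
    exact (norm_conjH1 u).le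

@[simp]
theorem conjL_apply (u : H1 Ω) : conjL Ω u = conjH1 u := rfl

/-- `H¹₀(Ω)` is stable under complex conjugation. -/
theorem conjH1_mem_H10 {u : H1 Ω} (hu : u ∈ H10 Ω) : conjH1 u ∈ H10 Ω := by
  have hle : H10 Ω ≤ (H10 Ω).comap (conjL Ω).toLinearMap := by
    refine Submodule.topologicalClosure_minimal _ (Submodule.span_le.2 ?_)
      ((isClosed_H10 Ω).preimage (conjL Ω).continuous)
    rintro u ⟨φ, hφ, hu⟩
    refine Submodule.le_topologicalClosure _ (Submodule.subset_span ⟨_, hφ.conj, ?_⟩)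
    filter_upwards [hu, Lp.coeFn_star (fn u)] with x hx hs
    change (star (fn u) : L2 Ω) x = _
    rw [hs, Pi.star_apply, hx]
    rfl
  exact hle hu

/-! ### Test functions inside the Sobolev space -/

/-- An `L²` function with vanishing integral against all test functions vanishes; hence weak
derivatives are unique. -/
theorem L2_eq_zero_of_integral_mul_eq_zero (hΩ : IsOpen Ω) {g : L2 Ω}
    (hg : ∀ φ : EuclideanSpace ℝ (Fin n) → ℂ, IsTestFunction Ω φ → ∫ x in Ω, g x * φ x = 0) :
    g = 0 := by
  apply Lp.ext
  refine EventuallyEq.trans ?_ (Lp.coeFn_zero ℂ 2 _).symm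
  have hloc : LocallyIntegrableOn g Ω :=
    locallyIntegrableOn_of_locallyIntegrable_restrict ((Lp.memLp g).locallyIntegrable (by norm_num))
  have h := hΩ.ae_eq_zero_of_integral_contDiff_smul_eq_zero hloc (μ := volume) ?_
  · exact (ae_restrict_iff' hΩ.measurableSet).2 h
  intro ψ hψ hc hs
  have hφ : IsTestFunction Ω fun x => (ψ x : ℂ) :=
    { contDiff := Complex.ofRealCLM.contDiff.comp hψ
      hasCompactSupport := hc.comp_left (g := fun r : ℝ => (r : ℂ)) Complex.ofReal_zero
      tsupport_subset := (tsupport_comp_subset (g := fun r : ℝ => (r : ℂ))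
        Complex.ofReal_zero ψ).trans hs }
  rw [← hg _ hφ, ← setIntegral_eq_integral_of_forall_compl_eq_zero (s := Ω)]
  · simp [mul_comm]
  · intro x hx
    rw [image_eq_zero_of_notMem_tsupport fun h => hx (hs h), zero_smul]

theorem IsWeakPartial.unique (hΩ : IsOpen Ω) {i : Fin n} {u g h : L2 Ω}
    (hg : IsWeakPartial Ω i u g) (hh : IsWeakPartial Ω i u h) : g = h := by
  rw [← sub_eq_zero]
  refine L2_eq_zero_of_integral_mul_eq_zero hΩ fun φ hφ => ?_
  have e : ∫ x in Ω, (g - h : L2 Ω) x * φ x = ∫ x in Ω, (g x * φ x - h x * φ x) := by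
    refine integral_congr_ae ?_
    filter_upwards [Lp.coeFn_sub g h] with x hx
    rw [hx, Pi.sub_apply, sub_mul]
  rw [e, integral_sub (integrable_L2_mul g hφ.memLp) (integrable_L2_mul h hφ.memLp), sub_eq_zero]
  exact neg_injective ((hg φ hφ).symm.trans (hh φ hφ))

theorem IsTestFunction.eq_zero {φ : EuclideanSpace ℝ (Fin n) → ℂ}
    (hφ : IsTestFunction Ω φ) {x : EuclideanSpace ℝ (Fin n)} (hx : x ∉ Ω) : φ x = 0 :=
  image_eq_zero_of_notMem_tsupport fun h => hx (hφ.tsupport_subset h)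

theorem IsTestFunction.continuous_partialDeriv {φ : EuclideanSpace ℝ (Fin n) → ℂ}
    (hφ : IsTestFunction Ω φ) (i : Fin n) : Continuous (partialDeriv i φ) :=
  (hφ.contDiff.continuous_fderiv (by simp)).clm_apply continuous_const

/-- The classical derivative of a test function is its weak derivative. -/
theorem IsTestFunction.isWeakPartial {φ : EuclideanSpace ℝ (Fin n) → ℂ}
    (hφ : IsTestFunction Ω φ) (i : Fin n) :
    IsWeakPartial Ω i hφ.memLp.toLp (hφ.memLp_partialDeriv i).toLp := by
  intro ψ hψ
  have e1 : ∫ x in Ω, hφ.memLp.toLp φ x * partialDeriv i ψ x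
      = ∫ x in Ω, φ x * partialDeriv i ψ x := by
    refine integral_congr_ae ?_
    filter_upwards [hφ.memLp.coeFn_toLp] with x hx
    rw [hx]
  have e2 : ∫ x in Ω, (hφ.memLp_partialDeriv i).toLp _ x * ψ x
      = ∫ x in Ω, partialDeriv i φ x * ψ x := by
    refine integral_congr_ae ?_
    filter_upwards [(hφ.memLp_partialDeriv i).coeFn_toLp] with x hx
    rw [hx]
  rw [e1, e2,
    setIntegral_eq_integral_of_forall_compl_eq_zero fun x hx => by rw [hφ.eq_zero hx, zero_mul],
    setIntegral_eq_integral_of_forall_compl_eq_zero fun x hx => by rw [hψ.eq_zero hx, mul_zero]]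
  refine integral_mul_fderiv_eq_neg_fderiv_mul_of_integrable ?_ ?_ ?_ ?_ ?_
  · exact ((hφ.continuous_partialDeriv i).mul hψ.contDiff.continuous).integrable_of_hasCompactSupport
      hψ.hasCompactSupport.mul_left
  · exact (hφ.contDiff.continuous.mul (hψ.continuous_partialDeriv i)).integrable_of_hasCompactSupport
      hφ.hasCompactSupport.mul_right
  · exact (hφ.contDiff.continuous.mul hψ.contDiff.continuous).integrable_of_hasCompactSupport
      hφ.hasCompactSupport.mul_right
  · exact fun x _ => hφ.contDiff.differentiable (by simp) x
  · exact fun x _ => hψ.contDiff.differentiable (by simp) x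

/-- A test function as an element of `H¹(Ω)`. -/
def IsTestFunction.toH1 {φ : EuclideanSpace ℝ (Fin n) → ℂ} (hφ : IsTestFunction Ω φ) : H1 Ω :=
  ⟨WithLp.toLp 2 (hφ.memLp.toLp, WithLp.toLp 2 fun i => (hφ.memLp_partialDeriv i).toLp),
    hφ.isWeakPartial⟩

theorem IsTestFunction.fn_toH1 {φ : EuclideanSpace ℝ (Fin n) → ℂ} (hφ : IsTestFunction Ω φ) :
    fn hφ.toH1 =ᵐ[volume.restrict Ω] φ :=
  hφ.memLp.coeFn_toLp

theorem IsTestFunction.toH1_mem_H10 {φ : EuclideanSpace ℝ (Fin n) → ℂ}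
    (hφ : IsTestFunction Ω φ) : hφ.toH1 ∈ H10 Ω :=
  Submodule.le_topologicalClosure _ (Submodule.subset_span ⟨φ, hφ, hφ.fn_toH1⟩)

theorem IsTestFunction.grad_ae_eq (hΩ : IsOpen Ω) {φ : EuclideanSpace ℝ (Fin n) → ℂ}
    (hφ : IsTestFunction Ω φ) {u : H1 Ω} (hu : fn u =ᵐ[volume.restrict Ω] φ) (i : Fin n) :
    grad u i =ᵐ[volume.restrict Ω] partialDeriv i φ := by
  have e : fn u = hφ.memLp.toLp := Lp.ext (hu.trans hφ.memLp.coeFn_toLp.symm)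
  have hw : IsWeakPartial Ω i (fn u) (grad u i) := u.2 i
  rw [e] at hw
  rw [hw.unique hΩ (hφ.isWeakPartial i)]
  exact (hφ.memLp_partialDeriv i).coeFn_toLp

/-! ### A Lax–Milgram theorem for sesquilinear forms -/

/-- Complex Lax–Milgram, relative to a subspace `V`: if the bounded sesquilinear form `a` is
coercive on `V`, every `u` can be corrected by an element of `V` so as to become `a`-orthogonal
to `V`, and the correction depends linearly and continuously on `u`. -/
theorem exists_continuousLinearMap_of_coercive_on {H : Type*} [NormedAddCommGroup H]
    [InnerProductSpace ℂ H] [CompleteSpace H] (V : Submodule ℂ H) [CompleteSpace V]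
    (a : H →L[ℂ] H →L⋆[ℂ] ℂ) {c : ℝ} (hc : 0 < c) (ha : ∀ v ∈ V, c * ‖v‖ ^ 2 ≤ (a v v).re) :
    ∃ S : H →L[ℂ] H, (∀ u, u - S u ∈ V) ∧ (∀ u, ∀ v ∈ V, a (S u) v = 0) := by
  let A : H →L[ℂ] H :=
    ContinuousLinearMap.adjoint (InnerProductSpace.continuousLinearMapOfBilin a.flip)
  have hA (v w : H) : inner ℂ v (A w) = a w v := by
    rw [ContinuousLinearMap.adjoint_inner_right, InnerProductSpace.continuousLinearMapOfBilin_apply,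
      ContinuousLinearMap.flip_apply]
  let Q : H →L[ℂ] V := (ContinuousLinearMap.adjoint V.subtypeL).comp A
  have hQ (v : V) (w : H) : inner ℂ v (Q w) = a w v := by
    rw [ContinuousLinearMap.comp_apply, ContinuousLinearMap.adjoint_inner_right]
    exact hA v w
  -- `T` represents the restriction of `a` to `V`.
  let T : V →L[ℂ] V := Q.comp V.subtypeL
  have hT : IsUnit T := by
    refine T.isUnit_of_forall_le_norm_inner_map (c := ⟨c, hc.le⟩) hc fun x => ?_
    rw [norm_inner_symm, ContinuousLinearMap.comp_apply, hQ, mul_comm]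
    exact (ha x x.2).trans (Complex.re_le_norm _)
  obtain ⟨R, hR⟩ := hT.exists_right_inv
  refine ⟨ContinuousLinearMap.id ℂ H - V.subtypeL.comp (R.comp Q), fun u => ?_, fun u v hv => ?_⟩
  · simp
  · have h : T (R (Q u)) = Q u := congrArg (fun f : V →L[ℂ] V => f (Q u)) hR
    have h' := hQ ⟨v, hv⟩ (V.subtypeL (R (Q u)))
    change inner ℂ _ (T (R (Q u))) = _ at h'
    rw [h, hQ] at h'
    simp only [sub_apply, map_sub, ContinuousLinearMap.id_apply,
      ContinuousLinearMap.comp_apply]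
    exact sub_eq_zero.2 h'

/-! ### The energy form -/

theorem IsAdmittivity.memLp {lam : ℝ} {γ : EuclideanSpace ℝ (Fin n) → ℂ}
    (hγ : IsAdmittivity Ω lam γ) : MemLp γ ⊤ (volume.restrict Ω) :=
  memLp_top_of_bound hγ.aestronglyMeasurable lam hγ.norm_le

theorem integrable_grad_mul_grad {γ : EuclideanSpace ℝ (Fin n) → ℂ}
    (hγ : MemLp γ ⊤ (volume.restrict Ω)) (u v : H1 Ω) (i : Fin n) :
    Integrable (fun x => γ x * (grad u i x * grad v i x)) (volume.restrict Ω) :=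
  ((Lp.memLp (grad u i)).integrable_mul (Lp.memLp (grad v i))).mul_of_top_right hγ

theorem integrable_gradForm {γ : EuclideanSpace ℝ (Fin n) → ℂ}
    (hγ : MemLp γ ⊤ (volume.restrict Ω)) (u v : H1 Ω) :
    Integrable (fun x => γ x * ∑ i, grad u i x * grad v i x) (volume.restrict Ω) := by
  simp_rw [Finset.mul_sum]
  exact integrable_finsetSum _ fun i _ => integrable_grad_mul_grad hγ u v i

theorem gradForm_comm (γ : EuclideanSpace ℝ (Fin n) → ℂ) (u v : H1 Ω) :
    gradForm γ u v = gradForm γ v u := by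
  simp only [gradForm, mul_comm (grad u _ _)]

/-- The energy form `(u, v) ↦ ∫_Ω γ ∇u · ∇v` of a bounded coefficient as a continuous bilinear
form on `H¹(Ω)`. -/
def gradFormL {γ : EuclideanSpace ℝ (Fin n) → ℂ} (hγ : MemLp γ ⊤ (volume.restrict Ω)) :
    H1 Ω →L[ℂ] H1 Ω →L[ℂ] ℂ :=
  ∑ i, (((ContinuousLinearMap.mul ℂ ℂ).lpPairing (volume.restrict Ω) 2 2).comp
    ((ContinuousLinearMap.mul ℂ ℂ).holderL (volume.restrict Ω) ⊤ 2 2 hγ.toLp)).bilinearComp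
      (gradL Ω i) (gradL Ω i)

@[simp]
theorem gradFormL_apply {γ : EuclideanSpace ℝ (Fin n) → ℂ} (hγ : MemLp γ ⊤ (volume.restrict Ω))
    (u v : H1 Ω) : gradFormL hγ u v = gradForm γ u v := by
  simp only [gradFormL, gradForm, Finset.mul_sum]
  rw [integral_finsetSum _ fun i _ => integrable_grad_mul_grad hγ u v i]
  simp only [sum_apply, ContinuousLinearMap.bilinearComp_apply,
    ContinuousLinearMap.comp_apply, ContinuousLinearMap.lpPairing_eq_integral, gradL_apply]
  refine Finset.sum_congr rfl fun i _ => integral_congr_ae ?_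
  filter_upwards [hγ.coeFn_toLp,
    (ContinuousLinearMap.mul ℂ ℂ).coeFn_holder (r := 2) hγ.toLp (grad u i)] with x h1 h2
  rw [ContinuousLinearMap.holderL_apply_apply, h2, h1]
  simp [mul_assoc]

/-- The sesquilinear energy form `(u, v) ↦ ∫_Ω γ ∇u · ∇v̄`. -/
def sesqFormL {γ : EuclideanSpace ℝ (Fin n) → ℂ} (hγ : MemLp γ ⊤ (volume.restrict Ω)) :
    H1 Ω →L[ℂ] H1 Ω →L⋆[ℂ] ℂ :=
  (gradFormL hγ).bilinearComp (ContinuousLinearMap.id ℂ _) (conjL Ω)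

@[simp]
theorem sesqFormL_apply {γ : EuclideanSpace ℝ (Fin n) → ℂ} (hγ : MemLp γ ⊤ (volume.restrict Ω))
    (u v : H1 Ω) : sesqFormL hγ u v = gradForm γ u (conjH1 v) :=
  gradFormL_apply hγ u (conjH1 v)

theorem gradForm_toH1 (γ : EuclideanSpace ℝ (Fin n) → ℂ) (hΩ : IsOpen Ω)
    {φ : EuclideanSpace ℝ (Fin n) → ℂ} (hφ : IsTestFunction Ω φ) (u : H1 Ω) {w : H1 Ω}
    (hw : fn w =ᵐ[volume.restrict Ω] φ) :
    gradForm γ u w = ∫ x in Ω, γ x * ∑ i, grad u i x * partialDeriv i φ x := by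
  refine integral_congr_ae ?_
  filter_upwards [ae_all_iff.2 fun i => hφ.grad_ae_eq hΩ hw i] with x hx
  simp only [hx]

/-- By density, a weak solution may be tested against all of `H¹₀(Ω)`. -/
theorem isWeakSolution_iff (hΩ : IsOpen Ω) {γ : EuclideanSpace ℝ (Fin n) → ℂ}
    (hγ : MemLp γ ⊤ (volume.restrict Ω)) {u : H1 Ω} :
    IsWeakSolution γ u ↔ ∀ w ∈ H10 Ω, gradForm γ u w = 0 := by
  constructor
  · intro h
    have hle : H10 Ω ≤ (gradFormL hγ u).ker := by
      refine Submodule.topologicalClosure_minimal _ (Submodule.span_le.2 ?_)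
        (gradFormL hγ u).isClosed_ker
      rintro w ⟨φ, hφ, hw⟩
      change gradFormL hγ u w = 0
      rw [gradFormL_apply, gradForm_toH1 γ hΩ hφ u hw, h φ hφ]
    intro w hw
    rw [← gradFormL_apply hγ]
    exact hle hw
  · intro h φ hφ
    rw [← gradForm_toH1 γ hΩ hφ u hφ.fn_toH1, h _ hφ.toH1_mem_H10]

theorem norm_sq_L2 (f : L2 Ω) : ‖f‖ ^ 2 = ∫ x in Ω, ‖f x‖ ^ 2 := by
  rw [← inner_self_eq_norm_sq (𝕜 := ℂ), L2.inner_def, ← integral_re (L2.integrable_inner f f)]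
  simp only [inner_self_eq_norm_sq]

theorem integrable_norm_sq_L2 (f : L2 Ω) :
    Integrable (fun x => ‖f x‖ ^ 2) (volume.restrict Ω) :=
  (Lp.memLp f).integrable_norm_pow (by norm_num)

theorem re_gradForm_conjH1_ge {lam : ℝ} {γ : EuclideanSpace ℝ (Fin n) → ℂ}
    (hγ : IsAdmittivity Ω lam γ) (u : H1 Ω) :
    lam⁻¹ * ∑ i, ‖grad u i‖ ^ 2 ≤ (gradForm γ u (conjH1 u)).re := by
  have hi := integrable_gradForm hγ.memLp u (conjH1 u)
  have hre : (gradForm γ u (conjH1 u)).re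
      = ∫ x in Ω, (γ x * ∑ i, grad u i x * grad (conjH1 u) i x).re :=
    (integral_re hi).symm
  rw [hre]
  simp only [norm_sq_L2]
  rw [← integral_finsetSum _ fun i _ => integrable_norm_sq_L2 (grad u i), ← integral_const_mul]
  refine integral_mono_ae ((integrable_finsetSum _ fun i _ =>
    integrable_norm_sq_L2 (grad u i)).const_mul _) hi.re ?_
  filter_upwards [hγ.re_ge, ae_all_iff.2 fun i => Lp.coeFn_star (grad u i)] with x hx hs
  have e : ∑ i, grad u i x * grad (conjH1 u) i x = ((∑ i, ‖grad u i x‖ ^ 2 : ℝ) : ℂ) := by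
    push_cast
    refine Finset.sum_congr rfl fun i _ => ?_
    rw [grad_conjH1, hs i]
    exact Complex.mul_conj' _
  change _ ≤ (γ x * _).re
  rw [e, Complex.re_mul_ofReal]
  gcongr

/-! ### The Poincaré inequality -/

theorem contDiff_coord (i : Fin n) : ContDiff ℝ ∞ fun x : EuclideanSpace ℝ (Fin n) => x i :=
  (EuclideanSpace.proj i : EuclideanSpace ℝ (Fin n) →L[ℝ] ℝ).contDiff

theorem IsTestFunction.coord_smul {φ : EuclideanSpace ℝ (Fin n) → ℂ} (hφ : IsTestFunction Ω φ)
    (i : Fin n) : IsTestFunction Ω fun x => x i • φ x where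
  contDiff := (contDiff_coord i).smul hφ.contDiff
  hasCompactSupport :=
    hφ.hasCompactSupport.smul_left (f := fun x : EuclideanSpace ℝ (Fin n) => x i)
  tsupport_subset :=
    (tsupport_smul_subset_right (fun x : EuclideanSpace ℝ (Fin n) => x i) φ).trans
      hφ.tsupport_subset

theorem IsTestFunction.partialDeriv_coord_smul {φ : EuclideanSpace ℝ (Fin n) → ℂ}
    (hφ : IsTestFunction Ω φ) (i : Fin n) (x : EuclideanSpace ℝ (Fin n)) :
    partialDeriv i (fun x => x i • φ x) x = φ x + x i • partialDeriv i φ x := by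
  have h1 : HasFDerivAt (fun x : EuclideanSpace ℝ (Fin n) => x i)
      (EuclideanSpace.proj i : EuclideanSpace ℝ (Fin n) →L[ℝ] ℝ) x :=
    (EuclideanSpace.proj i : EuclideanSpace ℝ (Fin n) →L[ℝ] ℝ).hasFDerivAt
  have h2 := (hφ.contDiff.differentiable (by simp) x).hasFDerivAt
  unfold partialDeriv
  rw [show (fun x : EuclideanSpace ℝ (Fin n) => x i • φ x)
    = (fun x : EuclideanSpace ℝ (Fin n) => x i) • φ from rfl, (h1.smul h2).fderiv]
  simp [add_comm]

/-- The Poincaré inequality for a test function, obtained by using `x_i φ̄` as test function in the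
definition of the weak derivative `∂φ/∂x_i`. -/
theorem norm_fn_le_of_isTestFunction (hΩ : IsOpen Ω) {R : ℝ} (hR : ∀ x ∈ Ω, ‖x‖ ≤ R) (i : Fin n)
    {φ : EuclideanSpace ℝ (Fin n) → ℂ} (hφ : IsTestFunction Ω φ) {u : H1 Ω}
    (hu : fn u =ᵐ[volume.restrict Ω] φ) : ‖fn u‖ ≤ 2 * R * ‖grad u i‖ := by
  have hg := hφ.grad_ae_eq hΩ hu i
  have hw : ∫ x in Ω, fn u x * partialDeriv i (fun x => x i • conj (φ x)) x
      = -∫ x in Ω, grad u i x * (x i • conj (φ x)) := u.2 i _ (hφ.conj.coord_smul i)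
  generalize fn u = f at *
  generalize grad u i = g at *
  have hb : ∀ᵐ x ∂(volume.restrict Ω), ‖x i • g x‖ ≤ R * ‖g x‖ := by
    filter_upwards [ae_restrict_mem hΩ.measurableSet] with x hx
    rw [norm_smul]
    gcongr
    exact (PiLp.norm_apply_le x i).trans (hR x hx)
  have hm : MemLp (fun x => x i • g x) 2 (volume.restrict Ω) :=
    (Lp.memLp g).of_le_mul
      ((contDiff_coord i).continuous.aestronglyMeasurable.smul (Lp.aestronglyMeasurable _)) hb
  obtain ⟨h, hh⟩ : ∃ h : L2 Ω, h =ᵐ[volume.restrict Ω] fun x => x i • g x :=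
    ⟨hm.toLp, hm.coeFn_toLp⟩
  have hle : ‖h‖ ≤ R * ‖g‖ := by
    refine Lp.norm_le_mul_norm_of_ae_le_mul ?_
    filter_upwards [hb, hh] with x h1 h2
    rwa [h2]
  have key : inner ℂ f f + inner ℂ h f = -inner ℂ f h := by
    rw [← inner_add_left, L2.inner_def, L2.inner_def]
    have e1 : ∫ x in Ω, inner ℂ ((f + h : L2 Ω) x) (f x)
        = ∫ x in Ω, f x * partialDeriv i (fun x => x i • conj (φ x)) x := by
      refine integral_congr_ae ?_
      filter_upwards [Lp.coeFn_add f h, hh, hu, hg] with x h1 h2 h3 h4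
      rw [hφ.conj.partialDeriv_coord_smul, hφ.partialDeriv_conj, RCLike.inner_apply, h1,
        Pi.add_apply, h2, h3, h4]
      simp
    have e2 : ∫ x in Ω, inner ℂ (f x) (h x) = ∫ x in Ω, g x * (x i • conj (φ x)) := by
      refine integral_congr_ae ?_
      filter_upwards [hh, hu] with x h2 h3
      rw [RCLike.inner_apply, h2, h3]
      simp only [Complex.real_smul]
      ring
    rw [e1, e2, hw]
  have hn : ‖f‖ ^ 2 ≤ 2 * (‖h‖ * ‖f‖) := by
    have e : inner ℂ f f = -inner ℂ f h - inner ℂ h f := by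
      rw [← key, add_sub_cancel_right]
    have e' : ‖inner ℂ f f‖ = ‖f‖ ^ 2 := by
      rw [inner_self_eq_norm_sq_to_K, norm_pow, RCLike.norm_ofReal, abs_norm]
    rw [← e', e]
    refine (norm_sub_le _ _).trans ?_
    rw [norm_neg, norm_inner_symm f h, two_mul]
    exact add_le_add (norm_inner_le_norm _ _) (norm_inner_le_norm _ _)
  rcases (norm_nonneg f).eq_or_lt with h0 | h0
  · have := (norm_nonneg h).trans hle
    linarith
  · nlinarith

theorem IsTestFunction.add {φ ψ : EuclideanSpace ℝ (Fin n) → ℂ} (hφ : IsTestFunction Ω φ)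
    (hψ : IsTestFunction Ω ψ) : IsTestFunction Ω (φ + ψ) where
  contDiff := hφ.contDiff.add hψ.contDiff
  hasCompactSupport := hφ.hasCompactSupport.add hψ.hasCompactSupport
  tsupport_subset := (tsupport_add φ ψ).trans
    (Set.union_subset hφ.tsupport_subset hψ.tsupport_subset)

theorem IsTestFunction.const_smul {φ : EuclideanSpace ℝ (Fin n) → ℂ} (hφ : IsTestFunction Ω φ)
    (c : ℂ) : IsTestFunction Ω (c • φ) where
  contDiff := contDiff_const.smul hφ.contDiff
  hasCompactSupport := hφ.hasCompactSupport.smul_left (f := fun _ => c)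
  tsupport_subset := (tsupport_smul_subset_right (fun _ => c) φ).trans hφ.tsupport_subset

variable (Ω) in
/-- The `H¹(Ω)` functions represented by test functions, as a subspace: `C_c^∞(Ω)` inside
`H¹(Ω)`. -/
def testFunctions : Submodule ℂ (H1 Ω) where
  carrier := {u | ∃ φ : EuclideanSpace ℝ (Fin n) → ℂ,
    IsTestFunction Ω φ ∧ fn u =ᵐ[volume.restrict Ω] φ}
  add_mem' := by
    rintro u v ⟨φ, hφ, hu⟩ ⟨ψ, hψ, hv⟩
    exact ⟨φ + ψ, hφ.add hψ, (Lp.coeFn_add (fn u) (fn v)).trans (hu.add hv)⟩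
  zero_mem' := ⟨0, ⟨contDiff_const, .zero, by simp [tsupport]⟩, Lp.coeFn_zero ℂ 2 _⟩
  smul_mem' := by
    rintro c u ⟨φ, hφ, hu⟩
    exact ⟨c • φ, hφ.const_smul c, (Lp.coeFn_smul c (fn u)).trans (hu.const_smul c)⟩

theorem H10_eq_closure : (H10 Ω : Set (H1 Ω)) = closure (testFunctions Ω) := by
  rw [← Submodule.topologicalClosure_coe, ← Submodule.span_eq (testFunctions Ω)]
  rfl

theorem norm_fn_le_of_mem_H10 (hΩ : IsOpen Ω) {R : ℝ} (hR : ∀ x ∈ Ω, ‖x‖ ≤ R) (i : Fin n)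
    {u : H1 Ω} (hu : u ∈ H10 Ω) : ‖fn u‖ ≤ 2 * R * ‖grad u i‖ := by
  have hc : IsClosed {u : H1 Ω | ‖fn u‖ ≤ 2 * R * ‖grad u i‖} :=
    isClosed_le (fnL Ω).continuous.norm (continuous_const.mul (gradL Ω i).continuous.norm)
  rw [← SetLike.mem_coe, H10_eq_closure] at hu
  refine closure_minimal ?_ hc hu
  rintro u ⟨φ, hφ, hu⟩
  exact norm_fn_le_of_isTestFunction hΩ hR i hφ hu

/-- The energy form is coercive on `H¹₀(Ω)`. -/
theorem exists_coercive_H10 (hn : 0 < n) (hΩ : IsOpen Ω) (hb : Bornology.IsBounded Ω) {lam : ℝ}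
    (hlam : 0 < lam) : ∃ c : ℝ, 0 < c ∧ ∀ γ : EuclideanSpace ℝ (Fin n) → ℂ,
      IsAdmittivity Ω lam γ → ∀ v ∈ H10 Ω, c * ‖v‖ ^ 2 ≤ (gradForm γ v (conjH1 v)).re := by
  obtain ⟨R, hR0, hR⟩ := hb.exists_pos_norm_le
  refine ⟨lam⁻¹ / (4 * R ^ 2 + 1), by positivity, fun γ hγ v hv => ?_⟩
  refine le_trans ?_ (re_gradForm_conjH1_ge hγ v)
  rw [div_mul_eq_mul_div, mul_div_assoc]
  gcongr
  rw [div_le_iff₀ (by positivity), norm_sq_H1]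
  have h1 : ‖fn v‖ ^ 2 ≤ 4 * R ^ 2 * ‖grad v ⟨0, hn⟩‖ ^ 2 :=
    (pow_le_pow_left₀ (norm_nonneg _) (norm_fn_le_of_mem_H10 hΩ hR ⟨0, hn⟩ hv) 2).trans_eq
      (by ring)
  have h2 : ‖grad v ⟨0, hn⟩‖ ^ 2 ≤ ∑ i, ‖grad v i‖ ^ 2 :=
    Finset.single_le_sum (f := fun i => ‖grad v i‖ ^ 2) (fun i _ => sq_nonneg _)
      (Finset.mem_univ _)
  nlinarith [mul_le_mul_of_nonneg_left h2 (by positivity : (0 : ℝ) ≤ 4 * R ^ 2)]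

/-! ### The Dirichlet problem and the Dirichlet-to-Neumann map -/

theorem trace_eq_trace_iff {u v : H1 Ω} : trace u = trace v ↔ u - v ∈ H10 Ω :=
  Submodule.Quotient.eq _

theorem IsWeakSolution.sub (hΩ : IsOpen Ω) {γ : EuclideanSpace ℝ (Fin n) → ℂ}
    (hγ : MemLp γ ⊤ (volume.restrict Ω)) {u v : H1 Ω} (hu : IsWeakSolution γ u)
    (hv : IsWeakSolution γ v) : IsWeakSolution γ (u - v) := by
  rw [isWeakSolution_iff hΩ hγ] at *
  intro w hw
  rw [← gradFormL_apply hγ, map_sub, sub_apply, gradFormL_apply,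
    gradFormL_apply, hu w hw, hv w hw, sub_zero]

/-- Uniqueness: a weak solution in `H¹₀(Ω)` vanishes, by coercivity of the energy form. -/
theorem IsWeakSolution.eq_zero_of_mem_H10 (hn : 0 < n) (hΩ : IsOpen Ω)
    (hb : Bornology.IsBounded Ω) {lam : ℝ} (hlam : 0 < lam)
    {γ : EuclideanSpace ℝ (Fin n) → ℂ} (hγ : IsAdmittivity Ω lam γ) {u : H1 Ω}
    (hu : IsWeakSolution γ u) (h0 : u ∈ H10 Ω) : u = 0 := by
  obtain ⟨c, hc, hcoer⟩ := exists_coercive_H10 hn hΩ hb hlam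
  have h := hcoer γ hγ u h0
  rw [(isWeakSolution_iff hΩ hγ.memLp).1 hu _ (conjH1_mem_H10 h0), Complex.zero_re] at h
  have h2 : ‖u‖ ^ 2 ≤ 0 := nonpos_of_mul_nonpos_right h hc
  exact norm_eq_zero.1 (pow_eq_zero_iff two_ne_zero |>.1 (le_antisymm h2 (sq_nonneg _)))

/-- The Dirichlet problem has a bounded linear solution operator `H^{1/2}(∂Ω) → H¹(Ω)`. -/
theorem exists_solutionOperator (hn : 0 < n) (hΩ : IsOpen Ω) (hb : Bornology.IsBounded Ω)
    {lam : ℝ} (hlam : 0 < lam) {γ : EuclideanSpace ℝ (Fin n) → ℂ} (hγ : IsAdmittivity Ω lam γ) :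
    ∃ P : HHalf Ω →L[ℂ] H1 Ω, ∀ f, IsWeakSolution γ (P f) ∧ trace (P f) = f := by
  obtain ⟨c, hc, hcoer⟩ := exists_coercive_H10 hn hΩ hb hlam
  obtain ⟨S, hS, hS'⟩ := exists_continuousLinearMap_of_coercive_on (H := H1 Ω)
    (H10 Ω) (sesqFormL hγ.memLp) hc
    fun v hv => by
      rw [sesqFormL_apply]
      exact hcoer γ hγ v hv
  have hsol (u : H1 Ω) : IsWeakSolution γ (S u) := by
    rw [isWeakSolution_iff hΩ hγ.memLp]
    intro w hw
    have h := hS' u _ (conjH1_mem_H10 hw)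
    rwa [sesqFormL_apply, conjH1_conjH1] at h
  have hker : H10 Ω ≤ S.ker := fun u hu => by
    refine (hsol u).eq_zero_of_mem_H10 hn hΩ hb hlam hγ ?_
    have h := (H10 Ω).sub_mem hu (hS u)
    rwa [sub_sub_cancel] at h
  refine ⟨(H10 Ω).liftQL S hker, fun f => ?_⟩
  obtain ⟨u, rfl⟩ := (H10 Ω).mkQ_surjective f
  exact ⟨hsol u, (trace_eq_trace_iff.2 (hS u)).symm⟩

theorem existsUnique_isWeakSolution (hn : 0 < n) (hΩ : IsOpen Ω) (hb : Bornology.IsBounded Ω)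
    {lam : ℝ} (hlam : 0 < lam) {γ : EuclideanSpace ℝ (Fin n) → ℂ} (hγ : IsAdmittivity Ω lam γ)
    (f : HHalf Ω) : ∃! u : H1 Ω, IsWeakSolution γ u ∧ trace u = f := by
  obtain ⟨P, hP⟩ := exists_solutionOperator hn hΩ hb hlam hγ
  refine ⟨P f, hP f, fun u hu => sub_eq_zero.1 ?_⟩
  exact (hu.1.sub hΩ hγ.memLp (hP f).1).eq_zero_of_mem_H10 hn hΩ hb hlam hγ
    (trace_eq_trace_iff.1 (hu.2.trans (hP f).2.symm))

/-- For a weak solution `u`, the energy `∫_Ω γ ∇u · ∇v` depends only on the boundary value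
of `v`. -/
theorem IsWeakSolution.gradForm_congr (hΩ : IsOpen Ω) {γ : EuclideanSpace ℝ (Fin n) → ℂ}
    (hγ : MemLp γ ⊤ (volume.restrict Ω)) {u : H1 Ω} (hu : IsWeakSolution γ u) {v w : H1 Ω}
    (hvw : trace v = trace w) : gradForm γ u v = gradForm γ u w := by
  rw [← sub_eq_zero, ← gradFormL_apply hγ, ← gradFormL_apply hγ, ← map_sub, gradFormL_apply]
  exact (isWeakSolution_iff hΩ hγ).1 hu _ (trace_eq_trace_iff.1 hvw)

theorem trace_conjH1_congr {v w : H1 Ω} (h : trace v = trace w) :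
    trace (conjH1 v) = trace (conjH1 w) := by
  rw [trace_eq_trace_iff] at *
  have h' := conjH1_mem_H10 h
  rwa [← conjL_apply, map_sub] at h'

/-- With `P` the solution operator, `Λ f ψ = ∫_Ω γ ∇(P f) · ∇(conj (P ψ))` defines the
Dirichlet-to-Neumann map. -/
theorem isDirichletToNeumann_dirichletToNeumann (hn : 0 < n) (hΩ : IsOpen Ω)
    (hb : Bornology.IsBounded Ω) {lam : ℝ} (hlam : 0 < lam)
    {γ : EuclideanSpace ℝ (Fin n) → ℂ} (hγ : IsAdmittivity Ω lam γ) :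
    IsDirichletToNeumann γ (dirichletToNeumann Ω γ) := by
  have hex : ∃ Λ : HHalf Ω →L[ℂ] HNegHalf Ω, IsDirichletToNeumann γ Λ := by
    obtain ⟨P, hP⟩ := exists_solutionOperator hn hΩ hb hlam hγ
    refine ⟨(P.precomp ℂ).comp ((sesqFormL hγ.memLp).comp P), fun f ψ u v hu huf hv => ?_⟩
    have e : P f = u :=
      (existsUnique_isWeakSolution hn hΩ hb hlam hγ f).unique (hP f) ⟨hu, huf⟩
    change sesqFormL hγ.memLp (P f) (P ψ) = _
    rw [sesqFormL_apply, e]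
    exact hu.gradForm_congr hΩ hγ.memLp (trace_conjH1_congr ((hP ψ).2.trans hv.symm))
  rw [dirichletToNeumann, dif_pos hex]
  exact hex.choose_spec

/-- The weak formulation of the Dirichlet-to-Neumann map in terms of the bilinear pairing. -/
theorem IsDirichletToNeumann.apply_trace_conjH1 {γ : EuclideanSpace ℝ (Fin n) → ℂ}
    {Λ : HHalf Ω →L[ℂ] HNegHalf Ω} (hΛ : IsDirichletToNeumann γ Λ) {u : H1 Ω}
    (hu : IsWeakSolution γ u) (v : H1 Ω) :
    Λ (trace u) (trace (conjH1 v)) = gradForm γ u v := by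
  rw [hΛ _ _ u (conjH1 v) hu rfl rfl, conjH1_conjH1]

theorem dirichletToNeumann_symm (hn : 0 < n) (hΩ : IsOpen Ω)
    (hb : Bornology.IsBounded Ω) {lam : ℝ} (hlam : 0 < lam)
    {γ : EuclideanSpace ℝ (Fin n) → ℂ} (hγ : IsAdmittivity Ω lam γ) (u v : H1 Ω) :
    dirichletToNeumann Ω γ (trace u) (trace (conjH1 v)) =
      dirichletToNeumann Ω γ (trace v) (trace (conjH1 u)) := by
  have hΛ := isDirichletToNeumann_dirichletToNeumann hn hΩ hb hlam hγ
  obtain ⟨u', ⟨hu, hu'⟩, -⟩ := existsUnique_isWeakSolution hn hΩ hb hlam hγ (trace u)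
  obtain ⟨v', ⟨hv, hv'⟩, -⟩ := existsUnique_isWeakSolution hn hΩ hb hlam hγ (trace v)
  rw [← trace_conjH1_congr hu', ← trace_conjH1_congr hv', ← hu', ← hv',
    hΛ.apply_trace_conjH1 hu, hΛ.apply_trace_conjH1 hv, gradForm_comm]

/-- Alessandrini's identity. Symmetry of `Λ_{γ₁}` turns the pairing with `u₂` into the energy of
the solution `u₁`. -/
theorem alessandrini_identity (hn : 0 < n) (hΩ : IsOpen Ω)
    (hb : Bornology.IsBounded Ω) {lam : ℝ} (hlam : 0 < lam)
    {γ₁ γ₂ : EuclideanSpace ℝ (Fin n) → ℂ} (hγ₁ : IsAdmittivity Ω lam γ₁)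
    (hγ₂ : IsAdmittivity Ω lam γ₂) {u₁ u₂ : H1 Ω} (hu₁ : IsWeakSolution γ₁ u₁)
    (hu₂ : IsWeakSolution γ₂ u₂) :
    ∫ x in Ω, (γ₁ x - γ₂ x) * ∑ i, grad u₁ i x * grad u₂ i x =
      (dirichletToNeumann Ω γ₁ - dirichletToNeumann Ω γ₂) (trace u₂) (trace (conjH1 u₁)) := by
  rw [sub_apply, sub_apply, dirichletToNeumann_symm hn hΩ hb hlam hγ₁ u₂ u₁,
    (isDirichletToNeumann_dirichletToNeumann hn hΩ hb hlam hγ₁).apply_trace_conjH1 hu₁,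
    (isDirichletToNeumann_dirichletToNeumann hn hΩ hb hlam hγ₂).apply_trace_conjH1 hu₂,
    gradForm_comm γ₂]
  simp only [sub_mul]
  exact integral_sub (integrable_gradForm hγ₁.memLp u₁ u₂) (integrable_gradForm hγ₂.memLp u₁ u₂)

end EIT

end

theorem mainTheorem7 {n : ℕ} (hn : 2 ≤ n) (Ω : Set (EuclideanSpace ℝ (Fin n)))
    (hΩo : IsOpen Ω) (hΩb : Bornology.IsBounded Ω) (lam : ℝ) (hlam : 1 ≤ lam) :
    -- for every admissible coefficient the boundary value problem is well posed, the
    -- Dirichlet-to-Neumann map is a well-defined operator, and it is symmetric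
    (∀ γ : EuclideanSpace ℝ (Fin n) → ℂ, EIT.IsAdmittivity Ω lam γ →
      (∀ f : EIT.HHalf Ω, ∃! u : EIT.H1 Ω, EIT.IsWeakSolution γ u ∧ EIT.trace u = f) ∧
      EIT.IsDirichletToNeumann γ (EIT.dirichletToNeumann Ω γ) ∧
      (∀ u v : EIT.H1 Ω,
        EIT.dirichletToNeumann Ω γ (EIT.trace u) (EIT.trace (EIT.conjH1 v)) =
          EIT.dirichletToNeumann Ω γ (EIT.trace v) (EIT.trace (EIT.conjH1 u)))) ∧
    -- the identity
    (∀ γ₁ γ₂ : EuclideanSpace ℝ (Fin n) → ℂ,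
      EIT.IsAdmittivity Ω lam γ₁ → EIT.IsAdmittivity Ω lam γ₂ →
      ∀ u₁ u₂ : EIT.H1 Ω, EIT.IsWeakSolution γ₁ u₁ → EIT.IsWeakSolution γ₂ u₂ →
        ∫ x in Ω, (γ₁ x - γ₂ x) * ∑ i, EIT.grad u₁ i x * EIT.grad u₂ i x =
          (EIT.dirichletToNeumann Ω γ₁ - EIT.dirichletToNeumann Ω γ₂)
            (EIT.trace u₂) (EIT.trace (EIT.conjH1 u₁))) := by
  have hn' : 0 < n := by omega
  have hl : 0 < lam := by linarith
  exact ⟨fun γ hγ => ⟨EIT.existsUnique_isWeakSolution hn' hΩo hΩb hl hγ,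
    EIT.isDirichletToNeumann_dirichletToNeumann hn' hΩo hΩb hl hγ,
    EIT.dirichletToNeumann_symm hn' hΩo hΩb hl hγ⟩,
    fun _ _ hγ₁ hγ₂ _ _ hu₁ hu₂ => EIT.alessandrini_identity hn' hΩo hΩb hl hγ₁ hγ₂ hu₁ hu₂⟩
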